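/- Let $K\ge 2$ be the number of arms, $\tau\in\mathbb R$ a threshold and $R>0$. A problem instance $(M,\mu)$ consists of a mean vector $\mu\in\mathbb R^K$ and a preference matrix $M\in[0,1]^{K\times K}$ with $M_{ij}+M_{ji}=1$ for all $i,j$. Write $S_\tau=\{i:\mu_i\ge\tau\}$ and $p_i=\frac1{K-1}\sum_{j\ne i}M_{ij}$; an instance is required to satisfy $p_i>p_j$ for all $i\in S_\tau$, $j\notin S_\tau$. In each round an algorithm, possibly randomized and using only its past decisions and observations (and not the unknown $(M,\mu)$), either pulls an arm $i$ and observes an independent draw from $\mathcal N(\mu_i,R^2)$, or duels two arms $i,j$ and observes an independent Bernoulli($M_{ij}$) outcome, or stops and outputs a set of arms. It recovers $S_\tau$ on an instance with probability at least $1-\delta$ if, under the law of the interaction with that instance, with probability at least $1-\delta$ it stops and its output equals $S_\tau$. Let $0<\delta\le 0.15$, and let $\mathcal A$ be an algorithm that recovers $S_\tau$ with probability at least $1-\delta$ on every instance in which no $\mu_i$ equals $\tau$. Let $(M,\mu)$ be an instance on which $\mathcal A$ recovers $S_\tau$ with probability at least $1-\delta$ (in particular, any instance in which no $\mu_i$ equals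 $\tau$), with $M_{ij}\ge\frac38$ for all $i,j\in[K]$, and let $k\in S_\tau$. Let $\Delta_k=|\mu_k-\tau|$ and $\Delta^c_k=p_k-\min_{i\in S_\tau}p_i$, and let $T^{\mathrm{duel}}_k$ and $T^{\mathrm{pull}}_k$ be the numbers of duels in which arm $k$ takes part and of pulls of arm $k$ made by $\mathcal A$ before it stops. Then $$\mathbb E_{M,\mu}\!\left[(\Delta^c_k)^2\,T^{\mathrm{duel}}_k+(\Delta_k)^2\,T^{\mathrm{pull}}_k\right]\ \ge\ c\,\log\frac1{2\delta},\qquad c=\min\left\{\tfrac1{10},\tfrac{R^2}{2}\right\},$$ where the expectation may be $+\infty$, and $0\cdot\infty=0$. -/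

import Mathlib

open MeasureTheory ProbabilityTheory
open scoped ENNReal NNReal

noncomputable section

namespace DuelBandit

/-- The score (Borda score) of arm `i` for a preference matrix `M`: the probability that `i` beats
a uniformly chosen other arm. -/
def score {K : ℕ} (M : Fin K → Fin K → ℝ) (i : Fin K) : ℝ :=
  (1 / ((K : ℝ) - 1)) * ∑ j ∈ Finset.univ.erase i, M i j

/-- A problem instance with `K` arms and threshold `τ`: mean rewards `μ` and a preference matrix
`M`, where every arm with mean at least `τ` has a larger score than every arm with mean
below `τ`. -/
structure Problem (K : ℕ) (τ : ℝ) where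
  μ : Fin K → ℝ
  M : Fin K → Fin K → ℝ
  M_nonneg : ∀ i j, 0 ≤ M i j
  M_add_swap : ∀ i j, M i j + M j i = 1
  score_lt : ∀ i j, τ ≤ μ i → μ j < τ → score M j < score M i

namespace Problem

variable {K : ℕ} {τ : ℝ}

/-- The positive arms. -/
def posSet (I : Problem K τ) : Finset (Fin K) := Finset.univ.filter fun i => τ ≤ I.μ i

/-- The gap between the mean of arm `i` and the threshold. -/
def pullGap (I : Problem K τ) (i : Fin K) : ℝ := |I.μ i - τ|

/-- The duel gap: the distance from the score of `i` to the lowest score of a positive arm if `i`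
is positive, and to the highest score of a negative arm if `i` is negative. -/
def duelGap (I : Problem K τ) (i : Fin K) : ℝ :=
  if τ ≤ I.μ i then score I.M i - ⨅ j : {j : Fin K // τ ≤ I.μ j}, score I.M j
  else (⨆ j : {j : Fin K // I.μ j < τ}, score I.M j) - score I.M i

end Problem

/-- What an algorithm does in one round: pull an arm, duel two arms, or stop and output a set of
arms as its estimate of the positive set. -/
inductive Decision (K : ℕ) where
  | pull (i : Fin K)
  | duel (i j : Fin K)
  | halt (S : Finset (Fin K))

instance (K : ℕ) : MeasurableSpace (Decision K) := ⊤

/-- The decision taken in a round, with the value observed. -/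
abbrev Round (K : ℕ) : Type := Decision K × ℝ

/-- A (possibly randomized) algorithm: the law of its first decision, and the conditional law of
its next decision given the rounds `0, …, n`. Decisions after the first `halt` are ignored. -/
structure Algorithm (K : ℕ) where
  first : Measure (Decision K)
  isProbabilityMeasure_first : IsProbabilityMeasure first
  next : (n : ℕ) → Kernel (Finset.Iic n → Round K) (Decision K)
  isMarkovKernel_next : ∀ n, IsMarkovKernel (next n)

/-- The law of the observation: `N(μ i, R²)` for a pull of `i`; for a duel of `i` and `j`, the
value `1` with probability `M i j` and `0` otherwise; a dummy value `0` for `halt`. -/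
def obsLaw {K : ℕ} {τ : ℝ} (I : Problem K τ) (R : ℝ≥0) : Decision K → Measure ℝ
  | .pull i => gaussianReal (I.μ i) (R ^ 2)
  | .duel i j => ENNReal.ofReal (I.M i j) • Measure.dirac 1
      + ENNReal.ofReal (1 - I.M i j) • Measure.dirac 0
  | .halt _ => Measure.dirac 0

/-- `obsLaw` as a kernel. -/
def obs {K : ℕ} {τ : ℝ} (I : Problem K τ) (R : ℝ≥0) : Kernel (Decision K) ℝ where
  toFun := obsLaw I R
  measurable' := measurable_from_top

instance {K : ℕ} {τ : ℝ} (I : Problem K τ) (R : ℝ≥0) : IsMarkovKernel (obs I R) := by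
  refine ⟨fun d => ?_⟩
  change IsProbabilityMeasure (obsLaw I R d)
  cases d with
  | pull i => unfold obsLaw; infer_instance
  | duel i j =>
    refine ⟨?_⟩
    have h0 := I.M_nonneg i j
    have h1 := I.M_nonneg j i
    have h2 := I.M_add_swap i j
    simp only [obsLaw, Measure.add_apply, Measure.smul_apply, measure_univ, smul_eq_mul, mul_one]
    rw [← ENNReal.ofReal_add h0 (by linarith)]
    simp
  | halt S => unfold obsLaw; infer_instance

/-- A round is not a `halt`. -/
def Decision.Active {K : ℕ} : Decision K → Prop
  | .halt _ => False
  | _ => True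

/-- The decision is a duel in which arm `k` takes part. -/
def Decision.IsDuelOf {K : ℕ} (k : Fin K) : Decision K → Prop
  | .duel i j => i = k ∨ j = k
  | _ => False

/-- The decision is a pull of arm `k`. -/
def Decision.IsPullOf {K : ℕ} (k : Fin K) : Decision K → Prop
  | .pull i => i = k
  | _ => False

/-- The algorithm has not stopped before round `t`. -/
def RunningAt {K : ℕ} (ω : ℕ → Round K) (t : ℕ) : Prop := ∀ s < t, (ω s).1.Active

open Classical in
/-- The number of duels in which arm `k` takes part, up to stopping. -/
def numDuels {K : ℕ} (k : Fin K) (ω : ℕ → Round K) : ℝ≥0∞ :=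
  ∑' t, if RunningAt ω t ∧ (ω t).1.IsDuelOf k then 1 else 0

open Classical in
/-- The number of pulls of arm `k`, up to stopping. -/
def numPulls {K : ℕ} (k : Fin K) (ω : ℕ → Round K) : ℝ≥0∞ :=
  ∑' t, if RunningAt ω t ∧ (ω t).1.IsPullOf k then 1 else 0

/-- The algorithm stops, and outputs `S`. -/
def Outputs {K : ℕ} (S : Finset (Fin K)) (ω : ℕ → Round K) : Prop :=
  ∃ t, RunningAt ω t ∧ (ω t).1 = .halt S

namespace Algorithm

variable {K : ℕ} {τ : ℝ}

instance (A : Algorithm K) : IsProbabilityMeasure A.first := A.isProbabilityMeasure_first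

instance (A : Algorithm K) (n : ℕ) : IsMarkovKernel (A.next n) := A.isMarkovKernel_next n

/-- The law of round `n + 1` given the rounds `0, …, n`: the decision is drawn from the algorithm,
and the observation, given everything else, from the law of that decision. -/
def step (A : Algorithm K) (I : Problem K τ) (R : ℝ≥0) (n : ℕ) :
    Kernel (Finset.Iic n → Round K) (Round K) :=
  A.next n ⊗ₖ Kernel.prodMkLeft _ (obs I R)

instance (A : Algorithm K) (I : Problem K τ) (R : ℝ≥0) (n : ℕ) :
    IsMarkovKernel (A.step I R n) := by
  unfold step; infer_instance

/-- The law of the sequence of rounds of algorithm `A` on the instance `I`, with Gaussian rewards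
of standard deviation `R`. -/
def law (A : Algorithm K) (I : Problem K τ) (R : ℝ≥0) : Measure (ℕ → Round K) :=
  Kernel.trajMeasure (X := fun _ => Round K) (A.first ⊗ₘ obs I R) (A.step I R)

/-- On the instance `I`, the algorithm stops and outputs exactly the positive set, with
probability at least `1 - δ`. -/
def Recovers (A : Algorithm K) (I : Problem K τ) (R : ℝ≥0) (δ : ℝ) : Prop :=
  ENNReal.ofReal (1 - δ) ≤ A.law I R {ω | Outputs I.posSet ω}

end Algorithm

end DuelBandit

end

/-! The proof is a change of measure. Compare `I` with an instance `J` in which `k` is negative: its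
mean becomes `τ - ε`, and its winning probabilities drop by `d = g + ε`, where `g` is the duel gap
of `k`. The score of `k` then lies strictly below those of the other positive arms, while all other
scores rise by the same amount, so `J` is admissible. The other positive arms move up by `ε`, so
that no mean of `J` equals `τ` and `A` must succeed there. Hence `A` outputs `I.posSet` with
probability at least `1 - δ` on `I` and at most `δ` on `J`.

These two probabilities force the relative entropy of the stopped histories to be at least `(1 - 2 *
δ) * log ((1 - δ) / δ)`, which dominates `log (1 / (2 * δ))` (`log_inv_two_mul_le`). By the chain
rule (`integral_stoppedFun_le`) it is at most the expected sum of one-round costs before stopping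
(`RelEntropyLE.obs_lower`): `10 * d ^ 2` for a duel of `k`, `(p + ε) ^ 2 / (2 * R ^ 2)` for a pull
of `k`, where `p` is the pull gap, and an error `ε ^ 2 / (2 * R ^ 2)` per round.

Everything is done up to a finite horizon `n`, since the expected stopping time may be infinite.
First `ε → 0` with `n` fixed, which removes the accumulated error; then `n → ∞`.

Relative entropy is used only through its variational inequality. No density on the path space is
needed, and stopping amounts to restricting the test functions. -/

noncomputable section

namespace DuelBandit

/-- The relative entropy of `P` with respect to `Q` is at most `c`, in the variational form
`∫ f ∂P ≤ c + ∫ exp f ∂Q - 1` for all bounded measurable `f`. -/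
def RelEntropyLE {Ω : Type*} [MeasurableSpace Ω] (P Q : Measure Ω) (c : ℝ) : Prop :=
  ∀ f : Ω → ℝ, Measurable f → (∃ B, ∀ x, |f x| ≤ B) →
    ∫ x, f x ∂P ≤ c + ∫ x, Real.exp (f x) ∂Q - 1

/-! ### Relative entropy: Gaussian and Bernoulli bounds, chain rule -/

section General

variable {Ω : Type*} [MeasurableSpace Ω]

lemma integrable_of_abs_le {P : Measure Ω} [IsFiniteMeasure P] {f : Ω → ℝ} (hf : Measurable f)
    {B : ℝ} (hB : ∀ x, |f x| ≤ B) : Integrable f P :=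
  Integrable.of_bound hf.aestronglyMeasurable B (Filter.Eventually.of_forall hB)

lemma abs_exp_le {α : Type*} {f : α → ℝ} {B : ℝ} (hB : ∀ x, |f x| ≤ B) (x : α) :
    |Real.exp (f x)| ≤ Real.exp B := by
  rw [Real.abs_exp]
  exact Real.exp_le_exp.2 (le_trans (le_abs_self _) (hB x))

lemma RelEntropyLE.mono {P Q : Measure Ω} {c c' : ℝ} (h : RelEntropyLE P Q c) (hc : c ≤ c') :
    RelEntropyLE P Q c' := fun f hf hB => by linarith [h f hf hB]

lemma RelEntropyLE.refl (P : Measure Ω) [IsProbabilityMeasure P] : RelEntropyLE P P 0 := by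
  rintro f hf ⟨B, hB⟩
  have h : ∫ x, f x ∂P ≤ ∫ x, (Real.exp (f x) - 1) ∂P :=
    integral_mono (integrable_of_abs_le hf hB)
      ((integrable_of_abs_le hf.exp (abs_exp_le hB)).sub (integrable_const _))
      fun x => by linarith [Real.add_one_le_exp (f x)]
  rw [integral_sub (integrable_of_abs_le hf.exp (abs_exp_le hB)) (integrable_const _)] at h
  simpa using h

/-- If `Q` has density `exp (-l)` with respect to `P`, then the relative entropy is `∫ l ∂P`. -/
lemma RelEntropyLE.of_withDensity {P : Measure Ω} [IsProbabilityMeasure P] {l : Ω → ℝ}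
    (hl : Measurable l) (hli : Integrable l P)
    [IsFiniteMeasure (P.withDensity fun x => ENNReal.ofReal (Real.exp (-l x)))] :
    RelEntropyLE P (P.withDensity fun x => ENNReal.ofReal (Real.exp (-l x))) (∫ x, l x ∂P) := by
  rintro f hf ⟨B, hB⟩
  have hm : Measurable fun x => (Real.exp (-l x)).toNNReal := hl.neg.exp.real_toNNReal
  have hd : (fun x => ENNReal.ofReal (Real.exp (-l x)))
      = fun x => (((Real.exp (-l x)).toNNReal : ℝ≥0) : ℝ≥0∞) := rfl
  have hsm : ∀ x, (Real.exp (-l x)).toNNReal • Real.exp (f x) = Real.exp (f x - l x) := by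
    intro x
    rw [NNReal.smul_def, Real.coe_toNNReal _ (Real.exp_pos _).le, smul_eq_mul, ← Real.exp_add]
    ring_nf
  have hfi := integrable_of_abs_le (P := P) hf hB
  have hei : Integrable (fun x => Real.exp (f x - l x)) P := by
    have := integrable_of_abs_le
      (P := P.withDensity fun x => ENNReal.ofReal (Real.exp (-l x))) hf.exp (abs_exp_le hB)
    rw [hd, integrable_withDensity_iff_integrable_smul hm] at this
    simpa only [hsm] using this
  rw [hd, integral_withDensity_eq_integral_smul hm]
  simp only [hsm]
  -- The variational inequality is the integral of `u + 1 ≤ exp u` at `u = f - l`.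
  have h : ∫ x, (f x - l x) ∂P ≤ ∫ x, (Real.exp (f x - l x) - 1) ∂P :=
    integral_mono (hfi.sub hli) (hei.sub (integrable_const _))
      fun x => by linarith [Real.add_one_le_exp (f x - l x)]
  rw [integral_sub hei (integrable_const _), integral_sub hfi hli] at h
  simp only [integral_const, probReal_univ, smul_eq_mul, mul_one] at h
  linarith

/-- With equal variances the log-likelihood ratio `l` is affine in `x`, so its integral requires
only the mean. -/
lemma RelEntropyLE.gaussianReal (m m' : ℝ) {v : ℝ≥0} (hv : v ≠ 0) :
    RelEntropyLE (gaussianReal m v) (gaussianReal m' v) ((m - m') ^ 2 / (2 * v)) := by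
  have hv' : (0 : ℝ) < v := by positivity
  let l : ℝ → ℝ := fun x => ((x - m') ^ 2 - (x - m) ^ 2) / (2 * v)
  have hl : l = fun x => x * ((m - m') / v) + (m' ^ 2 - m ^ 2) / (2 * v) := by
    funext x
    simp only [l]
    field_simp
    ring
  have hlm : Measurable l := by fun_prop
  have hid : Integrable (fun x : ℝ => x) (ProbabilityTheory.gaussianReal m v) :=
    (memLp_id_gaussianReal' 1 (by simp)).integrable le_rfl
  have hli : Integrable l (ProbabilityTheory.gaussianReal m v) := by
    rw [hl]
    exact (hid.mul_const _).add (integrable_const _)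
  have hint : ∫ x, l x ∂ProbabilityTheory.gaussianReal m v = (m - m') ^ 2 / (2 * v) := by
    rw [hl, integral_add (hid.mul_const _) (integrable_const _), integral_mul_const,
      integral_id_gaussianReal]
    simp only [integral_const, probReal_univ, smul_eq_mul, one_mul]
    field_simp
    ring
  have hden : ProbabilityTheory.gaussianReal m' v
      = (ProbabilityTheory.gaussianReal m v).withDensity
        fun x => ENNReal.ofReal (Real.exp (-l x)) := by
    rw [gaussianReal_of_var_ne_zero _ hv, gaussianReal_of_var_ne_zero _ hv,
      ← withDensity_mul _ (measurable_gaussianPDF _ _) (by fun_prop)]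
    congr 1
    funext x
    simp only [Pi.mul_apply, gaussianPDF]
    rw [← ENNReal.ofReal_mul (gaussianPDFReal_nonneg _ _ _)]
    congr 1
    simp only [gaussianPDFReal]
    rw [mul_assoc _ _ (Real.exp (-l x)), ← Real.exp_add]
    congr 2
    simp only [l]
    field_simp
    ring
  rw [← hint]
  have : IsFiniteMeasure ((ProbabilityTheory.gaussianReal m v).withDensity
      fun x => ENNReal.ofReal (Real.exp (-l x))) := by
    rw [← hden]; infer_instance
  rw [hden]
  exact RelEntropyLE.of_withDensity hlm hli

/-- The contribution of one atom to the `χ²` bound: `p * a - q * exp a` is maximal at `a = log (p /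
q)`, and there `log (p / q) ≤ p / q - 1`. -/
lemma mul_le_mul_exp_add {p q : ℝ} (hp : 0 < p) (hq : 0 < q) (a : ℝ) :
    p * a ≤ q * Real.exp a + p ^ 2 / q - 2 * p := by
  have h1 := Real.add_one_le_exp (a - Real.log (p / q))
  have h2 := Real.log_le_sub_one_of_pos (div_pos hp hq)
  rw [Real.exp_sub, Real.exp_log (div_pos hp hq)] at h1
  have h3 : a ≤ Real.exp a / (p / q) + p / q - 2 := by linarith
  calc p * a ≤ p * (Real.exp a / (p / q) + p / q - 2) := mul_le_mul_of_nonneg_left h3 hp.le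
    _ = _ := by field_simp

/-- The Bernoulli law on `{0, 1} ⊆ ℝ`: the relative entropy is at most the `χ²` divergence. -/
lemma RelEntropyLE.bernoulli {p q : ℝ} (hp : 0 < p) (hp1 : p < 1) (hq : 0 < q) (hq1 : q < 1) :
    RelEntropyLE
      (ENNReal.ofReal p • Measure.dirac (1 : ℝ) + ENNReal.ofReal (1 - p) • Measure.dirac 0)
      (ENNReal.ofReal q • Measure.dirac (1 : ℝ) + ENNReal.ofReal (1 - q) • Measure.dirac 0)
      ((p - q) ^ 2 / (q * (1 - q))) := by
  have key : ∀ (r : ℝ), 0 ≤ r → r ≤ 1 → ∀ g : ℝ → ℝ, Measurable g →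
      ∫ x, g x ∂(ENNReal.ofReal r • Measure.dirac (1 : ℝ)
        + ENNReal.ofReal (1 - r) • Measure.dirac 0) = r * g 1 + (1 - r) * g 0 := by
    intro r hr0 hr1 g hg
    have hi : ∀ a : ℝ, Integrable g (Measure.dirac a) := fun a =>
      integrable_dirac (by simp)
    rw [integral_add_measure ((hi 1).smul_measure (by simp)) ((hi 0).smul_measure (by simp)),
      integral_smul_measure, integral_smul_measure, integral_dirac, integral_dirac,
      ENNReal.toReal_ofReal hr0, ENNReal.toReal_ofReal (by linarith), smul_eq_mul, smul_eq_mul]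
  rintro f hf -
  rw [key p hp.le hp1.le f hf, key q hq.le hq1.le _ hf.exp]
  have h1 := mul_le_mul_exp_add hp hq (f 1)
  have h0 := mul_le_mul_exp_add (p := 1 - p) (q := 1 - q) (by linarith) (by linarith) (f 0)
  have hq' : 0 < 1 - q := by linarith
  have h2 : p ^ 2 / q + (1 - p) ^ 2 / (1 - q) = 1 + (p - q) ^ 2 / (q * (1 - q)) := by
    field_simp
    ring
  linarith

variable {Ω' : Type*} [MeasurableSpace Ω']

/-- Shifting `f` by the constant that normalises its exponential moment under `Q` to `1` yields the
Donsker–Varadhan form, which is what the conditional step of the chain rule needs. -/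
lemma RelEntropyLE.integral_le_log {P Q : Measure Ω} [IsProbabilityMeasure P]
    [IsProbabilityMeasure Q] {c : ℝ}
    (h : RelEntropyLE P Q c) {f : Ω → ℝ} (hf : Measurable f) {B : ℝ} (hB : ∀ x, |f x| ≤ B) :
    ∫ x, f x ∂P ≤ c + Real.log (∫ x, Real.exp (f x) ∂Q) := by
  have hi := integrable_of_abs_le (P := Q) hf.exp (abs_exp_le hB)
  have hpos : 0 < ∫ x, Real.exp (f x) ∂Q := integral_exp_pos hi
  set s := Real.log (∫ x, Real.exp (f x) ∂Q) with hs
  have := h (fun x => f x - s) (hf.sub_const _)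
    ⟨B + |s|, fun x => (abs_sub _ _).trans (by linarith [hB x])⟩
  simp only [Real.exp_sub] at this
  rw [integral_div, hs, Real.exp_log hpos, div_self hpos.ne',
    integral_sub (integrable_of_abs_le hf hB) (integrable_const _)] at this
  simp only [integral_const, probReal_univ, smul_eq_mul, one_mul] at this
  linarith

/-- The logarithm of the exponential moment of a bounded function under a Markov kernel. -/
def logMoment (η : Kernel Ω Ω') (F : Ω × Ω' → ℝ) (x : Ω) : ℝ :=
  Real.log (∫ y, Real.exp (F (x, y)) ∂η x)

lemma exp_logMoment (η : Kernel Ω Ω') [IsMarkovKernel η] {F : Ω × Ω' → ℝ} (hF : Measurable F)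
    {B : ℝ} (hB : ∀ z, |F z| ≤ B) (x : Ω) :
    Real.exp (logMoment η F x) = ∫ y, Real.exp (F (x, y)) ∂η x :=
  Real.exp_log (integral_exp_pos (integrable_of_abs_le
    (hF.comp measurable_prodMk_left).exp (abs_exp_le fun y => hB (x, y))))

lemma measurable_logMoment (η : Kernel Ω Ω') [IsMarkovKernel η] {F : Ω × Ω' → ℝ}
    (hF : Measurable F) : Measurable (logMoment η F) :=
  (hF.exp.stronglyMeasurable.integral_kernel_prod_right').measurable.log

lemma abs_logMoment_le (η : Kernel Ω Ω') [IsMarkovKernel η] {F : Ω × Ω' → ℝ}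
    (hF : Measurable F) {B : ℝ} (hB : ∀ z, |F z| ≤ B) (x : Ω) : |logMoment η F x| ≤ B := by
  have hi := integrable_of_abs_le (P := η x) (hF.comp (measurable_prodMk_left (x := x))).exp
    (abs_exp_le fun y => hB (x, y))
  have h1 : ∫ y, Real.exp (F (x, y)) ∂η x ≤ ∫ _, Real.exp B ∂η x :=
    integral_mono hi (integrable_const _) fun y =>
      Real.exp_le_exp.2 ((le_abs_self _).trans (hB (x, y)))
  have h2 : ∫ _, Real.exp (-B) ∂η x ≤ ∫ y, Real.exp (F (x, y)) ∂η x :=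
    integral_mono (integrable_const _) hi fun y =>
      Real.exp_le_exp.2 (by linarith [(abs_le.1 (hB (x, y))).1])
  simp only [integral_const, probReal_univ, smul_eq_mul, one_mul] at h1 h2
  rw [← exp_logMoment η hF hB] at h1 h2
  exact abs_le.2 ⟨Real.exp_le_exp.1 h2, Real.exp_le_exp.1 h1⟩

/-- One step of the chain rule, for a single test function. -/
lemma integral_compProd_le {μ ν : Measure Ω} [IsProbabilityMeasure μ] [IsProbabilityMeasure ν]
    {κ η : Kernel Ω Ω'} [IsMarkovKernel κ] [IsMarkovKernel η] {F : Ω × Ω' → ℝ}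
    (hF : Measurable F) {B : ℝ} (hB : ∀ z, |F z| ≤ B) {C : Ω → ℝ} (hC : Integrable C μ)
    (h : ∀ x, ∫ y, F (x, y) ∂κ x ≤ C x + logMoment η F x) {c₀ : ℝ}
    (h₀ : ∫ x, logMoment η F x ∂μ ≤ c₀ + ∫ x, Real.exp (logMoment η F x) ∂ν - 1) :
    ∫ z, F z ∂(μ ⊗ₘ κ) ≤ c₀ + ∫ x, C x ∂μ + ∫ z, Real.exp (F z) ∂(ν ⊗ₘ η) - 1 := by
  have hFi := integrable_of_abs_le (P := μ ⊗ₘ κ) hF hB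
  rw [Measure.integral_compProd hFi,
    Measure.integral_compProd (integrable_of_abs_le hF.exp (abs_exp_le hB))]
  have hg := integrable_of_abs_le (P := μ) (measurable_logMoment η hF) (abs_logMoment_le η hF hB)
  have hFk : Integrable (fun x => ∫ y, F (x, y) ∂κ x) μ :=
    Integrable.of_bound
      hF.stronglyMeasurable.integral_kernel_prod_right'.aestronglyMeasurable B
      (Filter.Eventually.of_forall fun x =>
        (norm_integral_le_of_norm_le_const
          (Filter.Eventually.of_forall fun y => hB (x, y))).trans (by simp))
  -- The log moment is itself a test function for the first marginals, and its exponential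
  -- integrates under `ν` to the exponential moment of `F` under `ν ⊗ₘ η`.
  have h1 := integral_mono hFk (hC.add hg) h
  rw [integral_add' hC hg] at h1
  simp only [exp_logMoment η hF hB] at h₀
  linarith

/-- The chain rule for relative entropy. -/
lemma RelEntropyLE.compProd {μ ν : Measure Ω} [IsProbabilityMeasure μ] [IsProbabilityMeasure ν]
    {κ η : Kernel Ω Ω'} [IsMarkovKernel κ] [IsMarkovKernel η] {c₀ : ℝ} {C : Ω → ℝ}
    (h₀ : RelEntropyLE μ ν c₀) (hC : Integrable C μ)
    (h : ∀ x, RelEntropyLE (κ x) (η x) (C x)) :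
    RelEntropyLE (μ ⊗ₘ κ) (ν ⊗ₘ η) (c₀ + ∫ x, C x ∂μ) := by
  rintro F hF ⟨B, hB⟩
  exact integral_compProd_le hF hB hC
    (fun x => (h x).integral_le_log (hF.comp measurable_prodMk_left) fun y => hB (x, y))
    (h₀ _ (measurable_logMoment η hF) ⟨B, abs_logMoment_le η hF hB⟩)

end General

/-- The difference `φ` of the two sides is decreasing on `(0, 0.15]` and still nonnegative at
`0.15`. -/
lemma log_inv_two_mul_le {δ : ℝ} (hδ0 : 0 < δ) (hδ : δ ≤ 0.15) :
    Real.log (1 / (2 * δ)) ≤ (1 - 2 * δ) * Real.log ((1 - δ) / δ) := by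
  let φ : ℝ → ℝ := fun x => (1 - 2 * x) * Real.log (1 - x) + 2 * x * Real.log x + Real.log 2
  have hder : ∀ x, 0 < x → x < 1 → HasDerivAt φ
      (2 * Real.log x - 2 * Real.log (1 - x) + 1 / (1 - x)) x := by
    intro x hx0 hx1
    have hx1' : 1 - x ≠ 0 := by linarith
    have h1 : HasDerivAt (fun x : ℝ => 1 - 2 * x) (-2) x := by
      simpa using ((hasDerivAt_id x).const_mul 2).const_sub 1
    have h2 : HasDerivAt (fun x : ℝ => Real.log (1 - x)) (-1 / (1 - x)) x :=
      ((hasDerivAt_id x).const_sub 1).log hx1'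
    have h3 : HasDerivAt (fun x : ℝ => 2 * x) 2 x := by
      simpa using (hasDerivAt_id x).const_mul 2
    have h4 := Real.hasDerivAt_log hx0.ne'
    refine (((h1.mul h2).add (h3.mul h4)).add_const (Real.log 2)).congr_deriv ?_
    field_simp
    ring
  have hanti : AntitoneOn φ (Set.Ioc 0 0.15) := by
    refine antitoneOn_of_deriv_nonpos (convex_Ioc _ _) (fun x hx => ?_) (fun x hx => ?_)
      (fun x hx => ?_)
    · exact (hder x hx.1 (by linarith [hx.2])).continuousAt.continuousWithinAt
    · rw [interior_Ioc] at hx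
      exact (hder x hx.1 (by linarith [hx.2])).differentiableAt.differentiableWithinAt
    · rw [interior_Ioc] at hx
      have hx0 : 0 < x := hx.1
      have hx1 : x < 0.15 := hx.2
      have hx1' : 0 < 1 - x := by linarith
      rw [(hder x hx0 (by linarith)).deriv]
      have h1 := Real.log_le_sub_one_of_pos (div_pos hx0 hx1')
      rw [Real.log_div hx0.ne' hx1'.ne'] at h1
      have h2 : x / (1 - x) ≤ 3 / 17 := by
        rw [div_le_div_iff₀ hx1' (by norm_num)]; linarith
      have h3 : 1 / (1 - x) ≤ 20 / 17 := by
        rw [div_le_div_iff₀ hx1' (by norm_num)]; linarith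
      linarith
  have h15 : 0 ≤ φ 0.15 := by
    have e1 : Real.log (1 - 0.15) = Real.log 17 - Real.log 20 := by
      rw [← Real.log_div (by norm_num) (by norm_num)]; norm_num
    have e2 : Real.log (0.15 : ℝ) = Real.log 3 - Real.log 20 := by
      rw [← Real.log_div (by norm_num) (by norm_num)]; norm_num
    have e3 : Real.log 20 = Real.log 2 + Real.log 10 := by
      rw [← Real.log_mul (by norm_num) (by norm_num)]; norm_num
    -- After division by `10`, this is exactly `0 ≤ φ 0.15`.
    have h : Real.log ((10 : ℝ) ^ 10) ≤ Real.log (17 ^ 7 * 3 ^ 3) :=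
      Real.log_le_log (by norm_num) (by norm_num)
    rw [Real.log_mul (by norm_num) (by norm_num), Real.log_pow, Real.log_pow, Real.log_pow] at h
    simp only [φ]
    rw [e1, e2, e3]
    push_cast at h
    linarith
  have hφ := h15.trans (hanti ⟨hδ0, hδ⟩ ⟨by norm_num, le_rfl⟩ hδ)
  simp only [φ] at hφ
  rw [one_div, Real.log_inv, Real.log_mul two_ne_zero hδ0.ne',
    Real.log_div (by linarith) hδ0.ne']
  linarith

/-! ### Chain rule along the trajectory, up to stopping -/

section Trajectory

open Preorder

variable {K : ℕ} {τ : ℝ}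

instance (A : Algorithm K) (I : Problem K τ) (R : ℝ≥0) : IsProbabilityMeasure (A.law I R) := by
  unfold Algorithm.law; infer_instance

lemma Algorithm.step_apply (A : Algorithm K) (I : Problem K τ) (R : ℝ≥0) (n : ℕ)
    (h : Finset.Iic n → Round K) : A.step I R n h = A.next n h ⊗ₘ obs I R := by
  rw [Algorithm.step, Kernel.compProd_apply_eq_compProd_sectR, Kernel.sectR_prodMkLeft]

lemma Algorithm.map_law_succ (A : Algorithm K) (I : Problem K τ) (R : ℝ≥0) (n : ℕ) :
    (A.law I R).map (frestrictLe n) ⊗ₘ A.step I R n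
      = (A.law I R).map fun ω => (frestrictLe n ω, ω (n + 1)) :=
  Kernel.map_frestrictLe_trajMeasure_compProd_eq_map_trajMeasure

lemma Algorithm.map_law_zero (A : Algorithm K) (I : Problem K τ) (R : ℝ≥0) :
    (A.law I R).map (fun ω => ω 0) = A.first ⊗ₘ obs I R := by
  have h : (fun ω : ℕ → Round K => ω 0)
      = (fun h : Finset.Iic 0 → Round K => h ⟨0, by simp⟩) ∘ frestrictLe 0 := rfl
  rw [h, ← Measure.map_map (by fun_prop) (by fun_prop), Algorithm.law, Kernel.trajMeasure,
    Measure.map_comp _ _ (by fun_prop), Kernel.traj_map_frestrictLe, Kernel.partialTraj_self,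
    Measure.id_comp, Measure.map_map (by fun_prop) (by fun_prop)]
  exact Measure.map_id

/-- No round before `t` of the history `h` is a `halt`. -/
def HistRunning {n : ℕ} (h : Finset.Iic n → Round K) (t : ℕ) : Prop :=
  ∀ s : Finset.Iic n, s.1 < t → (h s).1.Active

/-- The function `f` of the history does not depend on the rounds after the first `halt`. -/
def StoppedFun {n : ℕ} (f : (Finset.Iic n → Round K) → ℝ) : Prop :=
  ∀ h h' : Finset.Iic n → Round K,
    (∀ t : Finset.Iic n, HistRunning h t → h t = h' t) → f h = f h'

lemma histRunning_frestrictLe {n t : ℕ} (ht : t ≤ n + 1) (ω : ℕ → Round K) :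
    HistRunning (frestrictLe n ω) t ↔ RunningAt ω t := by
  constructor
  · intro h s hs
    exact h ⟨s, Finset.mem_Iic.2 (by omega)⟩ hs
  · intro h s hs
    exact h s hs

/-- Append a round to a history. -/
def snoc {n : ℕ} (z : (Finset.Iic n → Round K) × Round K) : Finset.Iic (n + 1) → Round K :=
  fun i => if hi : i.1 ≤ n then z.1 ⟨i, Finset.mem_Iic.2 hi⟩ else z.2

lemma measurable_snoc {n : ℕ} : Measurable (snoc (K := K) (n := n)) := by
  refine measurable_pi_lambda _ fun i => ?_
  by_cases hi : i.1 ≤ n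
  · simp only [snoc, hi, dif_pos]
    fun_prop
  · simp only [snoc, hi]
    exact measurable_snd

lemma snoc_frestrictLe {n : ℕ} (ω : ℕ → Round K) :
    snoc (frestrictLe n ω, ω (n + 1)) = frestrictLe (n + 1) ω := by
  funext i
  by_cases hi : i.1 ≤ n
  · simp [snoc, hi]
  · have : i.1 = n + 1 := by have := Finset.mem_Iic.1 i.2; omega
    simp [snoc, this]

lemma histRunning_snoc {n t : ℕ} (ht : t ≤ n + 1) (z : (Finset.Iic n → Round K) × Round K) :
    HistRunning (snoc z) t ↔ HistRunning z.1 t := by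
  constructor
  · intro h s hs
    have hsn : s.1 ≤ n := Finset.mem_Iic.1 s.2
    have := h ⟨s, Finset.mem_Iic.2 (by omega)⟩ hs
    simpa [snoc, hsn] using this
  · intro h s hs
    have hsn : s.1 ≤ n := by omega
    simpa [snoc, hsn] using h ⟨s, Finset.mem_Iic.2 hsn⟩ hs

lemma HistRunning.congr {n t : ℕ} {h h' : Finset.Iic n → Round K}
    (hh : ∀ t : Finset.Iic n, HistRunning h t → h t = h' t) (ht : HistRunning h t) :
    HistRunning h' t := by
  intro s hs
  rw [← hh s fun u hu => ht u (hu.trans hs)]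
  exact ht s hs

/-- After a `halt`, a stopped function does not depend on the last round. -/
lemma StoppedFun.snoc_eq {n : ℕ} {f : (Finset.Iic (n + 1) → Round K) → ℝ} (hf : StoppedFun f)
    {h h' : Finset.Iic n → Round K} (hh : ∀ t : Finset.Iic n, HistRunning h t → h t = h' t)
    (hn : ¬ HistRunning h (n + 1)) (x x' : Round K) : f (snoc (h, x)) = f (snoc (h', x')) := by
  refine hf _ _ fun t ht => ?_
  by_cases htn : t.1 ≤ n
  · simp only [snoc, htn, dif_pos]
    exact hh ⟨t, _⟩ ((histRunning_snoc (by omega) _).1 ht)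
  · have : t.1 = n + 1 := by have := Finset.mem_Iic.1 t.2; omega
    rw [this] at ht
    exact absurd ((histRunning_snoc le_rfl _).1 ht) hn

lemma measurableSet_histRunning {n : ℕ} (t : ℕ) :
    MeasurableSet {h : Finset.Iic n → Round K | HistRunning h t} := by
  simp only [HistRunning, Set.ofPred_forall]
  refine MeasurableSet.iInter fun s => MeasurableSet.iInter fun _ => ?_
  exact (measurable_fst.comp (measurable_pi_apply s))
    (MeasurableSpace.measurableSet_top (s := {d : Decision K | d.Active}))

lemma measurableSet_runningAt (t : ℕ) : MeasurableSet {ω : ℕ → Round K | RunningAt ω t} := by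
  simp only [RunningAt, Set.ofPred_forall]
  refine MeasurableSet.iInter fun s => MeasurableSet.iInter fun _ => ?_
  exact (measurable_fst.comp (measurable_pi_apply s))
    (MeasurableSpace.measurableSet_top (s := {d : Decision K | d.Active}))

open Classical in
/-- The cost of round `t`, which is zero once the algorithm has stopped. -/
def costAt (c : Decision K → ℝ) (t : ℕ) (ω : ℕ → Round K) : ℝ :=
  if RunningAt ω t then c (ω t).1 else 0

lemma measurable_costAt (c : Decision K → ℝ) (t : ℕ) : Measurable (costAt c t) := by
  classical
  unfold costAt
  exact Measurable.ite (measurableSet_runningAt t)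
    (measurable_from_top.comp (measurable_pi_apply t).fst) measurable_const

lemma abs_costAt_le {c : Decision K → ℝ} {b : ℝ} (hb : ∀ d, |c d| ≤ b) (t : ℕ)
    (ω : ℕ → Round K) : |costAt c t ω| ≤ b := by
  unfold costAt
  split_ifs
  · exact hb _
  · simpa using (abs_nonneg _).trans (hb (ω t).1)

lemma integral_fst_compProd_obs (P : Measure (Decision K)) [IsProbabilityMeasure P]
    (I : Problem K τ) (R : ℝ≥0) {c : Decision K → ℝ} {b : ℝ} (hb : ∀ d, |c d| ≤ b) :
    ∫ x, c x.1 ∂(P ⊗ₘ obs I R) = ∫ d, c d ∂P := by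
  have hm : Measurable fun x : Decision K × ℝ => c x.1 := measurable_from_top.comp measurable_fst
  rw [Measure.integral_compProd (integrable_of_abs_le hm fun x => hb x.1)]
  simp

/-- The relative entropy of the laws of the history up to stopping, on two instances, is at most
the expected total cost of the rounds, where the cost of a decision bounds the relative entropy of
the laws of the observation. -/
theorem integral_stoppedFun_le (A : Algorithm K) (I J : Problem K τ) (R : ℝ≥0)
    {c : Decision K → ℝ} {b : ℝ} (hb : ∀ d, |c d| ≤ b)
    (hc : ∀ d, RelEntropyLE (obs I R d) (obs J R d) (c d)) (n : ℕ)
    (f : (Finset.Iic n → Round K) → ℝ) (hf : Measurable f) (hfB : ∃ B, ∀ h, |f h| ≤ B)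
    (hfs : StoppedFun f) :
    ∫ ω, f (frestrictLe n ω) ∂(A.law I R)
      ≤ ∑ t ∈ Finset.range (n + 1), ∫ ω, costAt c t ω ∂(A.law I R)
        + ∫ ω, Real.exp (f (frestrictLe n ω)) ∂(A.law J R) - 1 := by
  have hci : ∀ P : Measure (Decision K), IsProbabilityMeasure P → Integrable c P := fun P _ =>
    integrable_of_abs_le measurable_from_top hb
  -- Given the past, the decision has the same law on both instances, so only the observation
  -- contributes to the entropy.
  have hround : ∀ P : Measure (Decision K), IsProbabilityMeasure P →
      RelEntropyLE (P ⊗ₘ obs I R) (P ⊗ₘ obs J R) (∫ x, c x.1 ∂(P ⊗ₘ obs I R)) := by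
    intro P hP
    have := (RelEntropyLE.refl P).compProd (hci P hP) hc
    rwa [zero_add, ← integral_fst_compProd_obs P I R hb] at this
  induction n with
  | zero =>
    obtain ⟨B, hB⟩ := hfB
    let e : Round K → (Finset.Iic 0 → Round K) := fun x _ => x
    have he : Measurable e := measurable_pi_lambda _ fun _ => measurable_id
    have hr : ∀ ω : ℕ → Round K, frestrictLe 0 ω = e (ω 0) := by
      intro ω
      funext i
      have : i.1 = 0 := by have := Finset.mem_Iic.1 i.2; omega
      simp [e, this]
    have h := hround A.first inferInstance (fun x => f (e x)) (hf.comp he) ⟨B, fun x => hB _⟩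
    have hcost : ∀ ω : ℕ → Round K, costAt c 0 ω = c (ω 0).1 := by
      intro ω
      simp [costAt, RunningAt]
    have hm : Measurable fun x : Round K => c x.1 := measurable_from_top.comp measurable_fst
    have hfe : Measurable fun x => f (e x) := hf.comp he
    have h0 : Measurable fun ω : ℕ → Round K => ω 0 := measurable_pi_apply 0
    rw [← A.map_law_zero I R, ← A.map_law_zero J R,
      integral_map h0.aemeasurable hfe.aestronglyMeasurable,
      integral_map h0.aemeasurable hfe.exp.aestronglyMeasurable,
      integral_map h0.aemeasurable hm.aestronglyMeasurable] at h
    simpa [hr, hcost] using h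
  | succ n ih =>
    classical
    obtain ⟨B, hB⟩ := hfB
    let F : (Finset.Iic n → Round K) × Round K → ℝ := fun z => f (snoc z)
    have hF : Measurable F := hf.comp measurable_snoc
    have hFB : ∀ z, |F z| ≤ B := fun z => hB _
    let G : (Finset.Iic n → Round K) × Round K → ℝ :=
      fun z => if HistRunning z.1 (n + 1) then c z.2.1 else 0
    have hG : Measurable G :=
      Measurable.ite (measurable_fst (measurableSet_histRunning (n + 1)))
        (measurable_from_top.comp measurable_snd.fst) measurable_const
    have hGB : ∀ z, |G z| ≤ b := by
      intro z
      simp only [G]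
      split_ifs
      · exact hb _
      · simpa using (abs_nonneg _).trans (hb z.2.1)
    have : IsProbabilityMeasure ((A.law I R).map (frestrictLe n)) :=
      Measure.isProbabilityMeasure_map (by fun_prop)
    have : IsProbabilityMeasure ((A.law J R).map (frestrictLe n)) :=
      Measure.isProbabilityMeasure_map (by fun_prop)
    have hGC : Integrable (fun h => ∫ x, G (h, x) ∂A.step I R n h)
        ((A.law I R).map (frestrictLe n)) :=
      Integrable.of_bound hG.stronglyMeasurable.integral_kernel_prod_right'.aestronglyMeasurable b
        (Filter.Eventually.of_forall fun h =>
          (norm_integral_le_of_norm_le_const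
            (Filter.Eventually.of_forall fun y => hGB (h, y))).trans (by simp))
    -- After a halt the test function ignores the new round, so taking its log moment changes
    -- nothing and the round costs nothing.
    have hhalt : ∀ h h' : Finset.Iic n → Round K,
        (∀ t : Finset.Iic n, HistRunning h t → h t = h' t) → ¬ HistRunning h (n + 1) →
        ∀ x, logMoment (A.step J R n) F h' = F (h, x) := by
      intro h h' hh hn x
      have : ∀ y, F (h', y) = F (h, x) := fun y => (hfs.snoc_eq hh hn x y).symm
      simp [logMoment, this]
    have hstep : ∀ h, ∫ x, F (h, x) ∂A.step I R n h
        ≤ ∫ x, G (h, x) ∂A.step I R n h + logMoment (A.step J R n) F h := by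
      intro h
      by_cases hr : HistRunning h (n + 1)
      · have := (hround (A.next n h) inferInstance).integral_le_log
          (hF.comp (measurable_prodMk_left (x := h))) fun y => hFB (h, y)
        rw [← A.step_apply, ← A.step_apply] at this
        simpa only [G, hr, if_true, logMoment, Function.comp_apply] using this
      · have h1 : ∀ x, F (h, x) = logMoment (A.step J R n) F h := fun x =>
          (hhalt h h (fun _ _ => rfl) hr x).symm
        simp [G, hr, h1]
    -- The log moment is again a stopped function, so the induction hypothesis applies to it: a
    -- history still running agrees entirely with `h'`, and a halted one is covered by `hhalt`.
    have hgs : StoppedFun (logMoment (A.step J R n) F) := by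
      intro h h' hh
      by_cases hr : HistRunning h (n + 1)
      · have : h = h' := by
          funext t
          have := Finset.mem_Iic.1 t.2
          exact hh t fun s hs => hr s (by omega)
        rw [this]
      · have hx : Round K := (.halt ∅, 0)
        rw [hhalt h h (fun _ _ => rfl) hr hx, hhalt h h' hh hr hx]
    have h₀ := ih (logMoment (A.step J R n) F) (measurable_logMoment _ hF)
      ⟨B, abs_logMoment_le _ hF hFB⟩ hgs
    have hlm := measurable_logMoment (A.step J R n) hF
    rw [← integral_map (φ := frestrictLe n) (μ := A.law I R) (by fun_prop)
        hlm.aestronglyMeasurable,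
      ← integral_map (φ := frestrictLe n) (μ := A.law J R)
        (f := fun h => Real.exp (logMoment (A.step J R n) F h)) (by fun_prop)
        hlm.exp.aestronglyMeasurable] at h₀
    have h1 := integral_compProd_le hF hFB hGC hstep h₀
    rw [← Measure.integral_compProd (integrable_of_abs_le hG hGB), A.map_law_succ,
      A.map_law_succ, integral_map (by fun_prop) hF.aestronglyMeasurable,
      integral_map (by fun_prop) hF.exp.aestronglyMeasurable,
      integral_map (by fun_prop) hG.aestronglyMeasurable] at h1
    have hcost : ∀ ω : ℕ → Round K, G (frestrictLe n ω, ω (n + 1)) = costAt c (n + 1) ω := by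
      intro ω
      simp only [G, costAt, histRunning_frestrictLe le_rfl]
    simp only [F, snoc_frestrictLe, hcost] at h1
    rw [Finset.sum_range_succ]
    exact h1

end Trajectory

/-! ### The alternative instance and the cost of one round -/

section Alternative

variable {K : ℕ} {τ : ℝ}

/-- The preference matrix `M` with the winning probabilities of arm `k` lowered by `d`. -/
def lowerRow (M : Fin K → Fin K → ℝ) (k : Fin K) (d : ℝ) (i j : Fin K) : ℝ :=
  if i = k then (if j = k then M i j else M i j - d) else (if j = k then M i j + d else M i j)

lemma score_lowerRow_self (hK : 2 ≤ K) (M : Fin K → Fin K → ℝ) (k : Fin K) (d : ℝ) :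
    score (lowerRow M k d) k = score M k - d := by
  have hK' : (0 : ℝ) < (K : ℝ) - 1 := by
    have : (2 : ℝ) ≤ K := by exact_mod_cast hK
    linarith
  have h : ∑ j ∈ Finset.univ.erase k, lowerRow M k d k j
      = ∑ j ∈ Finset.univ.erase k, M k j - ((K : ℝ) - 1) * d := by
    have : ∀ j ∈ Finset.univ.erase k, lowerRow M k d k j = M k j - d := by
      intro j hj
      simp [lowerRow, Finset.ne_of_mem_erase hj]
    rw [Finset.sum_congr rfl this, Finset.sum_sub_distrib, Finset.sum_const,
      Finset.card_erase_of_mem (Finset.mem_univ k), Finset.card_univ, Fintype.card_fin,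
      nsmul_eq_mul, Nat.cast_sub (by omega), Nat.cast_one]
  rw [score, score, h]
  field_simp

/-- Only the duel against `k` changes. The gain is the same for every `i ≠ k`, so the order among
these arms is preserved. -/
lemma score_lowerRow_of_ne (M : Fin K → Fin K → ℝ) {i k : Fin K} (hik : i ≠ k) (d : ℝ) :
    score (lowerRow M k d) i = score M i + 1 / ((K : ℝ) - 1) * d := by
  have h : ∑ j ∈ Finset.univ.erase i, lowerRow M k d i j
      = ∑ j ∈ Finset.univ.erase i, M i j + d := by
    have : ∀ j ∈ Finset.univ.erase i, lowerRow M k d i j = M i j + if j = k then d else 0 := by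
      intro j _
      by_cases hj : j = k <;> simp [lowerRow, hik, hj]
    rw [Finset.sum_congr rfl this, Finset.sum_add_distrib, Finset.sum_ite_eq',
      if_pos (Finset.mem_erase.2 ⟨hik.symm, Finset.mem_univ k⟩)]
  rw [score, score, h, mul_add]

lemma le_score (hK : 2 ≤ K) {M : Fin K → Fin K → ℝ} {a : ℝ} (h : ∀ i j, a ≤ M i j)
    (i : Fin K) : a ≤ score M i := by
  have hK' : (0 : ℝ) < (K : ℝ) - 1 := by
    have : (2 : ℝ) ≤ K := by exact_mod_cast hK
    linarith
  have := Finset.card_nsmul_le_sum (Finset.univ.erase i) (M i) a fun j _ => h i j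
  rw [Finset.card_erase_of_mem (Finset.mem_univ i), Finset.card_univ, Fintype.card_fin,
    nsmul_eq_mul, Nat.cast_sub (by omega), Nat.cast_one] at this
  rw [score, one_div, inv_mul_eq_div, le_div_iff₀ hK']
  linarith

lemma score_le (hK : 2 ≤ K) {M : Fin K → Fin K → ℝ} {a : ℝ} (h : ∀ i j, M i j ≤ a)
    (i : Fin K) : score M i ≤ a := by
  have := le_score hK (M := fun i j => -M i j) (a := -a) (fun i j => neg_le_neg (h i j)) i
  simp only [score, Finset.sum_neg_distrib, mul_neg, neg_le_neg_iff] at this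
  exact this

/-- The instance in which the arm `k` is moved just below the threshold, its winning probabilities
are lowered by `d`, and the other positive arms are moved up, off the threshold. -/
def Problem.lower (I : Problem K τ) (hK : 2 ≤ K) (k : Fin K) {ε d : ℝ} (hε : 0 < ε)
    (hd0 : 0 ≤ d) (hd : ∀ i, τ ≤ I.μ i → score I.M k - d < score I.M i)
    (hdM : ∀ j, d ≤ I.M k j) : Problem K τ where
  μ i := if i = k then τ - ε else if τ ≤ I.μ i then I.μ i + ε else I.μ i
  M := lowerRow I.M k d
  M_nonneg i j := by
    have h1 := I.M_nonneg i j
    unfold lowerRow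
    split_ifs with hi hj hj
    · exact h1
    · subst hi; linarith [hdM j]
    · linarith
    · exact h1
  M_add_swap i j := by
    have h1 := I.M_add_swap i j
    unfold lowerRow
    split_ifs <;> linarith
  score_lt i j hi hj := by
    have hK' : (0 : ℝ) < (K : ℝ) - 1 := by
      have : (2 : ℝ) ≤ K := by exact_mod_cast hK
      linarith
    have hi1 : i ≠ k := by
      intro h
      simp only [h, if_true] at hi
      linarith
    have hi2 : τ ≤ I.μ i := by
      by_contra h
      simp only [hi1, h, if_false] at hi
    rw [score_lowerRow_of_ne _ hi1]
    -- A negative arm of the new instance is either `k`, whose score was pushed below the old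
    -- positive scores, or an old negative arm, for which the old order persists.
    by_cases hjk : j = k
    · rw [hjk, score_lowerRow_self hK]
      have : 0 ≤ 1 / ((K : ℝ) - 1) * d := by positivity
      linarith [hd i hi2]
    · rw [score_lowerRow_of_ne _ hjk]
      have hj2 : I.μ j < τ := by
        by_contra h
        simp only [hjk, not_lt.1 h, if_false, if_true] at hj
        linarith [not_lt.1 h]
      linarith [I.score_lt i j hi2 hj2]

open Classical in
/-- A cost function: `a` for a duel of `k`, `b` for a pull of `k`, and `e` for every round. -/
def armCost (k : Fin K) (a b e : ℝ) (x : Decision K) : ℝ :=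
  (if x.IsDuelOf k then a else 0) + (if x.IsPullOf k then b else 0) + e

lemma abs_armCost_le (k : Fin K) {a b e : ℝ} (ha : 0 ≤ a) (hb : 0 ≤ b) (he : 0 ≤ e)
    (x : Decision K) : |armCost k a b e x| ≤ a + b + e := by
  unfold armCost
  split_ifs <;> rw [abs_of_nonneg (by linarith)] <;> linarith

/-- The observation laws differ only for duels of `k` with another arm, pulls of `k`, and pulls of
the other positive arms, which were moved by `ε`; the per-round term pays for the last. -/
lemma RelEntropyLE.obs_lower (I : Problem K τ) (hK : 2 ≤ K) (hM : ∀ i j, 3 / 8 ≤ I.M i j)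
    {R : ℝ≥0} (hR : 0 < R) {k : Fin K} (hk : τ ≤ I.μ k) {ε d : ℝ} (hε : 0 < ε) (hd0 : 0 ≤ d)
    (hd1 : d ≤ 26 / 100) (hd : ∀ i, τ ≤ I.μ i → score I.M k - d < score I.M i)
    (hdM : ∀ j, d ≤ I.M k j) (x : Decision K) :
    RelEntropyLE (obs I R x) (obs (I.lower hK k hε hd0 hd hdM) R x)
      (armCost k (10 * d ^ 2) ((I.pullGap k + ε) ^ 2 / (2 * (R : ℝ) ^ 2))
        (ε ^ 2 / (2 * (R : ℝ) ^ 2)) x) := by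
  have hR' : (0 : ℝ) < R := hR
  have he : 0 ≤ ε ^ 2 / (2 * (R : ℝ) ^ 2) := by positivity
  have hb : 0 ≤ (I.pullGap k + ε) ^ 2 / (2 * (R : ℝ) ^ 2) := by positivity
  have ha : 0 ≤ 10 * d ^ 2 := by positivity
  have hM1 : ∀ i j, I.M i j ≤ 5 / 8 := fun i j => by linarith [hM j i, I.M_add_swap i j]
  have hbern : ∀ p q : ℝ, 3 / 8 ≤ p → p ≤ 5 / 8 → (q = p - d ∨ q = p + d) → RelEntropyLE
      (ENNReal.ofReal p • Measure.dirac (1 : ℝ) + ENNReal.ofReal (1 - p) • Measure.dirac 0)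
      (ENNReal.ofReal q • Measure.dirac (1 : ℝ) + ENNReal.ofReal (1 - q) • Measure.dirac 0)
      (10 * d ^ 2) := by
    intro p q hp hp1 hq
    -- From `p ∈ [3/8, 5/8]` and `d ≤ 0.26`; then `q * (1 - q) ≥ 0.115 * 0.885 > 1/10`, the source
    -- of the factor `10`.
    have hq0 : 115 / 1000 ≤ q := by rcases hq with h | h <;> linarith
    have hq1 : q ≤ 885 / 1000 := by rcases hq with h | h <;> linarith
    refine (RelEntropyLE.bernoulli (by linarith) (by linarith) (by linarith) (by linarith)).mono ?_
    have hqq : 1 / 10 ≤ q * (1 - q) := by nlinarith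
    have hpq : (p - q) ^ 2 = d ^ 2 := by rcases hq with h | h <;> rw [h] <;> ring
    rw [hpq, div_le_iff₀ (by linarith)]
    nlinarith [sq_nonneg d]
  have hsame : ∀ y : Decision K, obsLaw I R y = obsLaw (I.lower hK k hε hd0 hd hdM) R y →
      RelEntropyLE (obsLaw I R y) (obsLaw (I.lower hK k hε hd0 hd hdM) R y)
      (armCost k (10 * d ^ 2) ((I.pullGap k + ε) ^ 2 / (2 * (R : ℝ) ^ 2))
        (ε ^ 2 / (2 * (R : ℝ) ^ 2)) y) := by
    intro y hy
    rw [← hy]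
    have : IsProbabilityMeasure (obsLaw I R y) := inferInstanceAs (IsProbabilityMeasure (obs I R y))
    refine (RelEntropyLE.refl _).mono ?_
    unfold armCost
    split_ifs <;> linarith
  change RelEntropyLE (obsLaw I R x) (obsLaw _ R x) _
  cases x with
  | halt S => exact hsame _ rfl
  | pull i =>
    refine (RelEntropyLE.gaussianReal _ _ (by positivity)).mono ?_
    simp only [armCost, Decision.IsDuelOf, Decision.IsPullOf, ↓reduceIte, zero_add, NNReal.coe_pow,
      Problem.lower]
    by_cases hik : i = k
    · have hgap : I.pullGap k = I.μ k - τ := abs_of_nonneg (by linarith)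
      simp only [hik, ↓reduceIte, hgap]
      have : I.μ k - (τ - ε) = I.μ k - τ + ε := by ring
      rw [this]
      linarith
    · simp only [hik, ↓reduceIte, zero_add]
      split_ifs
      · exact le_of_eq (by ring)
      · simpa using he
  | duel i j =>
    by_cases hi : i = k <;> by_cases hj : j = k
    · exact hsame _ (by simp [obsLaw, Problem.lower, lowerRow, hi, hj])
    · refine (hbern _ _ (hM i j) (hM1 i j) (Or.inl ?_)).mono ?_
      · simp [Problem.lower, lowerRow, hi, hj]
      · simp only [armCost, Decision.IsDuelOf, hi, true_or, Decision.IsPullOf, ↓reduceIte]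
        linarith
    · refine (hbern _ _ (hM i j) (hM1 i j) (Or.inr ?_)).mono ?_
      · simp [Problem.lower, lowerRow, hi, hj]
      · simp only [armCost, Decision.IsDuelOf, hj, or_true, Decision.IsPullOf, ↓reduceIte]
        linarith
    · exact hsame _ (by simp [obsLaw, Problem.lower, lowerRow, hi, hj])

lemma Problem.lower_mu_ne (I : Problem K τ) (hK : 2 ≤ K) (k : Fin K) {ε d : ℝ} (hε : 0 < ε)
    (hd0 : 0 ≤ d) (hd : ∀ i, τ ≤ I.μ i → score I.M k - d < score I.M i)
    (hdM : ∀ j, d ≤ I.M k j) (i : Fin K) : (I.lower hK k hε hd0 hd hdM).μ i ≠ τ := by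
  simp only [Problem.lower]
  split_ifs with h1 h2
  · linarith
  · linarith
  · exact fun h => h2 h.ge

lemma Problem.notMem_posSet_lower (I : Problem K τ) (hK : 2 ≤ K) (k : Fin K) {ε d : ℝ}
    (hε : 0 < ε) (hd0 : 0 ≤ d) (hd : ∀ i, τ ≤ I.μ i → score I.M k - d < score I.M i)
    (hdM : ∀ j, d ≤ I.M k j) : k ∉ (I.lower hK k hε hd0 hd hdM).posSet := by
  intro h
  have h1 := (Finset.mem_filter.1 h).2
  simp only [Problem.lower, if_true] at h1
  linarith

lemma Problem.score_sub_duelGap_le (I : Problem K τ) {k i : Fin K} (hk : τ ≤ I.μ k)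
    (hi : τ ≤ I.μ i) : score I.M k - I.duelGap k ≤ score I.M i := by
  rw [Problem.duelGap, if_pos hk, sub_sub_cancel]
  exact ciInf_le (Set.finite_range _).bddBelow (⟨i, hi⟩ : {j : Fin K // τ ≤ I.μ j})

lemma Problem.duelGap_nonneg (I : Problem K τ) {k : Fin K} (hk : τ ≤ I.μ k) :
    0 ≤ I.duelGap k := by
  linarith [I.score_sub_duelGap_le hk hk]

/-- All scores lie in `[3/8, 5/8]`. The bound leaves room for `ε ≤ 1/100` within `d ≤ 0.26`. -/
lemma Problem.duelGap_le (I : Problem K τ) (hK : 2 ≤ K) (hM : ∀ i j, 3 / 8 ≤ I.M i j)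
    {k : Fin K} (hk : τ ≤ I.μ k) : I.duelGap k ≤ 1 / 4 := by
  have h1 : score I.M k ≤ 5 / 8 :=
    score_le hK (fun i j => by linarith [hM j i, I.M_add_swap i j]) k
  have : Nonempty {j : Fin K // τ ≤ I.μ j} := ⟨⟨k, hk⟩⟩
  have h2 : 3 / 8 ≤ ⨅ j : {j : Fin K // τ ≤ I.μ j}, score I.M j :=
    le_ciInf fun j => le_score hK hM j
  rw [Problem.duelGap, if_pos hk]
  linarith

end Alternative

/-! ### From relative entropy to expected counts -/

section LowerBound

open Preorder Filter Topology

variable {K : ℕ} {τ : ℝ}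

/-- The algorithm stops at round `n` or before, and outputs `S`. -/
def OutputsBy (S : Finset (Fin K)) (n : ℕ) (ω : ℕ → Round K) : Prop :=
  ∃ t ≤ n, RunningAt ω t ∧ (ω t).1 = .halt S

lemma Outputs.unique {S S' : Finset (Fin K)} {ω : ℕ → Round K} (h : Outputs S ω)
    (h' : Outputs S' ω) : S = S' := by
  obtain ⟨t, ht, hS⟩ := h
  obtain ⟨t', ht', hS'⟩ := h'
  rcases lt_trichotomy t t' with hlt | rfl | hlt
  · have := ht' t hlt
    rw [hS] at this
    exact this.elim
  · rw [hS] at hS'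
    exact Decision.halt.inj hS'
  · have := ht t' hlt
    rw [hS'] at this
    exact this.elim

lemma measurableSet_running_and (t : ℕ) (p : Decision K → Prop) :
    MeasurableSet {ω : ℕ → Round K | RunningAt ω t ∧ p (ω t).1} :=
  (measurableSet_runningAt t).inter ((measurable_fst.comp (measurable_pi_apply t))
    (MeasurableSpace.measurableSet_top (s := {d : Decision K | p d})))

lemma measurableSet_outputsBy (S : Finset (Fin K)) (n : ℕ) :
    MeasurableSet {ω | OutputsBy S n ω} := by
  have : {ω | OutputsBy S n ω}
      = ⋃ t, ⋃ _ : t ≤ n, {ω : ℕ → Round K | RunningAt ω t ∧ (ω t).1 = .halt S} := by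
    ext ω; simp only [OutputsBy, Set.mem_iUnion, exists_prop]; rfl
  rw [this]
  exact MeasurableSet.iUnion fun t => MeasurableSet.iUnion fun _ =>
    measurableSet_running_and t fun d => d = .halt S

lemma iUnion_outputsBy (S : Finset (Fin K)) :
    ⋃ n, {ω | OutputsBy S n ω} = {ω | Outputs S ω} := by
  ext ω
  simp only [Set.mem_iUnion, Set.mem_ofPred_eq, OutputsBy, Outputs]
  exact ⟨fun ⟨_, t, _, h⟩ => ⟨t, h⟩, fun ⟨t, h⟩ => ⟨t, t, le_rfl, h⟩⟩

lemma measurableSet_outputs (S : Finset (Fin K)) : MeasurableSet {ω | Outputs S ω} := by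
  rw [← iUnion_outputsBy]
  exact MeasurableSet.iUnion fun n => measurableSet_outputsBy S n

lemma tendsto_outputsBy (P : Measure (ℕ → Round K)) [IsProbabilityMeasure P]
    (S : Finset (Fin K)) :
    Tendsto (fun n => P.real {ω | OutputsBy S n ω}) atTop (𝓝 (P.real {ω | Outputs S ω})) := by
  rw [← iUnion_outputsBy]
  refine (ENNReal.tendsto_toReal (measure_ne_top _ _)).comp
    (tendsto_measure_iUnion_atTop fun m n hmn ω => ?_)
  rintro ⟨t, ht, h⟩
  exact ⟨t, ht.trans hmn, h⟩

/-- Agreement is assumed only while `h` runs; strong induction on the round shows that `h` runs as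
long as `h'` does. -/
lemma HistRunning.congr_symm {n t : ℕ} {h h' : Finset.Iic n → Round K}
    (hh : ∀ t : Finset.Iic n, HistRunning h t → h t = h' t) (ht : HistRunning h' t) :
    HistRunning h t := by
  rintro ⟨s, hsn⟩ hs
  induction s using Nat.strong_induction_on with
  | _ s ih =>
    rw [hh ⟨s, hsn⟩ fun u hu => ih u.1 hu u.2 (lt_trans hu hs)]
    exact ht ⟨s, hsn⟩ hs

/-- The transportation inequality for the event that the algorithm outputs `S` by round `n`. -/
lemma transport_outputsBy (A : Algorithm K) (I J : Problem K τ) (R : ℝ≥0)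
    {c : Decision K → ℝ} {b : ℝ} (hb : ∀ d, |c d| ≤ b)
    (hc : ∀ d, RelEntropyLE (obs I R d) (obs J R d) (c d)) (S : Finset (Fin K)) {δ : ℝ}
    (hδ0 : 0 < δ) (hδ1 : δ < 1 / 2) (hJ : (A.law J R).real {ω | Outputs S ω} ≤ δ) (n : ℕ) :
    (2 * (A.law I R).real {ω | OutputsBy S n ω} - 1) * Real.log ((1 - δ) / δ)
      ≤ ∑ t ∈ Finset.range (n + 1), ∫ ω, costAt c t ω ∂(A.law I R) := by
  classical
  have hquot : 1 < (1 - δ) / δ := by rw [lt_div_iff₀ hδ0]; linarith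
  set L := Real.log ((1 - δ) / δ) with hL
  have hLpos : 0 < L := Real.log_pos hquot
  have hexp : Real.exp L = (1 - δ) / δ := Real.exp_log (by linarith)
  have hexp' : Real.exp (-L) = δ / (1 - δ) := by rw [Real.exp_neg, hexp, inv_div]
  let E : Set (Finset.Iic n → Round K) :=
    {h | ∃ t : Finset.Iic n, HistRunning h t ∧ (h t).1 = .halt S}
  have hE : MeasurableSet E := by
    have : E = ⋃ t : Finset.Iic n, ({h | HistRunning h t} ∩ {h | (h t).1 = .halt S}) := by
      ext h; simp [E]
    rw [this]
    refine MeasurableSet.iUnion fun t => (measurableSet_histRunning t.1).inter ?_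
    exact (measurable_fst.comp (measurable_pi_apply t))
      (MeasurableSpace.measurableSet_top (s := {d : Decision K | d = .halt S}))
  -- This is the log-likelihood ratio of Bernoulli(`1 - δ`) against Bernoulli(`δ`). Its exponential
  -- has mean `1` when the event has probability exactly `δ`, hence at most `1` under `J`, and its
  -- mean under `I` is `(2 * P(E) - 1) * L`.
  let f : (Finset.Iic n → Round K) → ℝ := fun h => if h ∈ E then L else -L
  have hf : Measurable f := Measurable.ite hE measurable_const measurable_const
  have hfB : ∀ h, |f h| ≤ L := by
    intro h
    simp only [f]
    split_ifs <;> simp [abs_of_pos hLpos]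
  have hfs : StoppedFun f := by
    intro h h' hh
    have hiff : h ∈ E ↔ h' ∈ E := by
      constructor
      · rintro ⟨t, ht, hS⟩
        exact ⟨t, ht.congr hh, by rw [← hh t ht]; exact hS⟩
      · rintro ⟨t, ht, hS⟩
        have ht' := HistRunning.congr_symm hh ht
        exact ⟨t, ht', by rw [hh t ht']; exact hS⟩
    simp only [f, hiff]
  have hmem : ∀ ω : ℕ → Round K, frestrictLe n ω ∈ E ↔ OutputsBy S n ω := by
    intro ω
    constructor
    · rintro ⟨t, ht, hS⟩
      have htn := Finset.mem_Iic.1 t.2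
      exact ⟨t, htn, (histRunning_frestrictLe (by omega) ω).1 ht, hS⟩
    · rintro ⟨t, htn, ht, hS⟩
      exact ⟨⟨t, Finset.mem_Iic.2 htn⟩, (histRunning_frestrictLe (by simp; omega) ω).2 ht, hS⟩
  have hint : ∀ (P : Measure (ℕ → Round K)) [IsProbabilityMeasure P] (u v : ℝ),
      ∫ ω, (if OutputsBy S n ω then u else v) ∂P
        = (u - v) * P.real {ω | OutputsBy S n ω} + v := by
    intro P _ u v
    have : ∀ ω, (if OutputsBy S n ω then u else v)
        = {ω | OutputsBy S n ω}.indicator (fun _ => u - v) ω + v := by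
      intro ω
      by_cases h : OutputsBy S n ω <;> simp [h]
    simp only [this]
    rw [integral_add ((integrable_const _).indicator (measurableSet_outputsBy S n))
      (integrable_const _), integral_indicator_const _ (measurableSet_outputsBy S n)]
    simp [mul_comm]
  have hmain := integral_stoppedFun_le A I J R hb hc n f hf ⟨L, hfB⟩ hfs
  simp only [f, hmem, apply_ite Real.exp] at hmain
  rw [hint, hint, hexp, hexp'] at hmain
  have hQ : (A.law J R).real {ω | OutputsBy S n ω} ≤ δ :=
    by
    refine (measureReal_mono ?_).trans hJ
    rintro ω ⟨t, -, h⟩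
    exact ⟨t, h⟩
  have hδ' : 0 < 1 - δ := by linarith
  have hpos : 0 ≤ (1 - δ) / δ - δ / (1 - δ) := by
    have : δ / (1 - δ) ≤ 1 := by rw [div_le_one hδ']; linarith
    linarith
  have h1 : ((1 - δ) / δ - δ / (1 - δ)) * (A.law J R).real {ω | OutputsBy S n ω}
      + δ / (1 - δ) ≤ 1 := by
    have h2 := mul_le_mul_of_nonneg_left hQ hpos
    have h3 : ((1 - δ) / δ - δ / (1 - δ)) * δ + δ / (1 - δ) = 1 := by
      field_simp
      ring
    linarith
  linarith

/-- Not an equality: the right side charges `e` even after stopping. -/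
lemma integral_costAt_armCost_le (P : Measure (ℕ → Round K)) [IsProbabilityMeasure P]
    (k : Fin K) {a b e : ℝ} (ha : 0 ≤ a) (hb : 0 ≤ b) (he : 0 ≤ e) (t : ℕ) :
    ∫ ω, costAt (armCost k a b e) t ω ∂P
      ≤ a * P.real {ω | RunningAt ω t ∧ (ω t).1.IsDuelOf k}
        + b * P.real {ω | RunningAt ω t ∧ (ω t).1.IsPullOf k} + e := by
  classical
  have hD := measurableSet_running_and t (Decision.IsDuelOf k)
  have hN := measurableSet_running_and t (Decision.IsPullOf k)
  have i1 : Integrable ({ω | RunningAt ω t ∧ (ω t).1.IsDuelOf k}.indicator fun _ => a) P :=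
    (integrable_const _).indicator hD
  have i2 : Integrable ({ω | RunningAt ω t ∧ (ω t).1.IsPullOf k}.indicator fun _ => b) P :=
    (integrable_const _).indicator hN
  calc ∫ ω, costAt (armCost k a b e) t ω ∂P
      ≤ ∫ ω, ({ω | RunningAt ω t ∧ (ω t).1.IsDuelOf k}.indicator (fun _ => a) ω
        + {ω | RunningAt ω t ∧ (ω t).1.IsPullOf k}.indicator (fun _ => b) ω + e) ∂P := by
        refine integral_mono (integrable_of_abs_le (measurable_costAt _ t)
          (abs_costAt_le (abs_armCost_le k ha hb he) t)) ((i1.add i2).add (integrable_const _))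
          fun ω => ?_
        by_cases hr : RunningAt ω t
        · simp [costAt, armCost, hr, Set.indicator_apply]
        · simpa [costAt, hr, Set.indicator_apply] using he
    _ = _ := by
        have h12 : Integrable (fun ω =>
            {ω | RunningAt ω t ∧ (ω t).1.IsDuelOf k}.indicator (fun _ => a) ω
              + {ω | RunningAt ω t ∧ (ω t).1.IsPullOf k}.indicator (fun _ => b) ω) P := i1.add i2
        rw [integral_add h12 (integrable_const _), integral_add i1 i2,
          integral_indicator_const _ hD, integral_indicator_const _ hN]
        simp [mul_comm]

lemma lintegral_tsum_running (P : Measure (ℕ → Round K)) (p : Decision K → Prop)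
    [∀ ω : ℕ → Round K, ∀ t, Decidable (RunningAt ω t ∧ p (ω t).1)] :
    ∫⁻ ω, ∑' t, (if RunningAt ω t ∧ p (ω t).1 then 1 else 0 : ℝ≥0∞) ∂P
      = ∑' t, P {ω | RunningAt ω t ∧ p (ω t).1} := by
  have hm := fun t => measurableSet_running_and (K := K) t p
  rw [lintegral_tsum fun t =>
    (Measurable.ite (hm t) measurable_const measurable_const).aemeasurable]
  refine tsum_congr fun t => ?_
  rw [← lintegral_indicator_one (hm t)]
  refine lintegral_congr fun ω => ?_
  simp [Set.indicator_apply]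

/-- Tonelli turns expected counts into series of probabilities. Partial sums stay real, so limits
can be taken even when the expectation is infinite. -/
lemma ofReal_sum_le_lintegral (P : Measure (ℕ → Round K)) [IsProbabilityMeasure P]
    (k : Fin K) {a b : ℝ} (ha : 0 ≤ a) (hb : 0 ≤ b) (n : ℕ) :
    ENNReal.ofReal
        (a * ∑ t ∈ Finset.range n, P.real {ω | RunningAt ω t ∧ (ω t).1.IsDuelOf k}
          + b * ∑ t ∈ Finset.range n, P.real {ω | RunningAt ω t ∧ (ω t).1.IsPullOf k})
      ≤ ∫⁻ ω, (ENNReal.ofReal a * numDuels k ω + ENNReal.ofReal b * numPulls k ω) ∂P := by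
  classical
  have hm : ∀ p : Decision K → Prop, Measurable fun ω : ℕ → Round K =>
      ∑' t, (if RunningAt ω t ∧ p (ω t).1 then 1 else 0 : ℝ≥0∞) := fun p =>
    Measurable.tsum fun t =>
      Measurable.ite (measurableSet_running_and t p) measurable_const measurable_const
  have hsum : ∀ s : ℕ → Set (ℕ → Round K),
      ENNReal.ofReal (∑ t ∈ Finset.range n, P.real (s t)) ≤ ∑' t, P (s t) := by
    intro s
    rw [ENNReal.ofReal_sum_of_nonneg fun _ _ => measureReal_nonneg]
    simp only [measureReal_def, ENNReal.ofReal_toReal (measure_ne_top P _)]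
    exact ENNReal.sum_le_tsum _
  unfold numDuels numPulls
  rw [lintegral_add_left ((hm _).const_mul _), lintegral_const_mul _ (hm _),
    lintegral_const_mul _ (hm _), lintegral_tsum_running, lintegral_tsum_running,
    ENNReal.ofReal_add (mul_nonneg ha (Finset.sum_nonneg fun _ _ => measureReal_nonneg))
      (mul_nonneg hb (Finset.sum_nonneg fun _ _ => measureReal_nonneg)),
    ENNReal.ofReal_mul ha, ENNReal.ofReal_mul hb]
  gcongr
  · exact hsum _
  · exact hsum _

/-- Outputs of distinct sets are disjoint events, so a wrong output lies within the failure
probability. -/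
lemma Algorithm.Recovers.measureReal_le {A : Algorithm K} {J : Problem K τ} {R : ℝ≥0} {δ : ℝ}
    (h : A.Recovers J R δ) {S : Finset (Fin K)} (hS : S ≠ J.posSet) :
    (A.law J R).real {ω | Outputs S ω} ≤ δ := by
  have h1 : 1 - δ ≤ (A.law J R).real {ω | Outputs J.posSet ω} :=
    (ENNReal.ofReal_le_iff_le_toReal (measure_ne_top _ _)).1 h
  have h2 : (A.law J R).real ({ω | Outputs S ω} ∪ {ω | Outputs J.posSet ω}) ≤ 1 :=
    measureReal_le_one
  have hdisj : Disjoint {ω | Outputs S ω} {ω | Outputs J.posSet ω} :=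
    Set.disjoint_left.2 fun ω hω hω' => hS (Outputs.unique hω hω')
  rw [measureReal_union hdisj (measurableSet_outputs _)] at h2
  linarith

end LowerBound

end DuelBandit

end

/-! ### The lower bound -/

open DuelBandit

theorem theorem2 {K : ℕ} (hK : 2 ≤ K) (τ : ℝ) (R : ℝ≥0) (hR : 0 < R)
    (δ : ℝ) (hδ0 : 0 < δ) (hδ : δ ≤ 0.15)
    (A : DuelBandit.Algorithm K)
    (hA : ∀ J : DuelBandit.Problem K τ, (∀ i, J.μ i ≠ τ) → A.Recovers J R δ)
    (I : DuelBandit.Problem K τ) (hI : A.Recovers I R δ)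
    (hM : ∀ i j, 3 / 8 ≤ I.M i j)
    (k : Fin K) (hk : k ∈ I.posSet) :
    ENNReal.ofReal (min (1 / 10) ((R : ℝ) ^ 2 / 2) * Real.log (1 / (2 * δ))) ≤
      ∫⁻ ω, (ENNReal.ofReal (I.duelGap k ^ 2) * DuelBandit.numDuels k ω
        + ENNReal.ofReal (I.pullGap k ^ 2) * DuelBandit.numPulls k ω) ∂(A.law I R) := by
  have hkτ : τ ≤ I.μ k := by simpa [Problem.posSet] using hk
  have hR' : (0 : ℝ) < R := hR
  set P := A.law I R with hP
  set g := I.duelGap k with hg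
  set p := I.pullGap k with hp
  have hg0 : 0 ≤ g := I.duelGap_nonneg hkτ
  have hg1 : g ≤ 1 / 4 := I.duelGap_le hK hM hkτ
  have hδ' : δ < 1 / 2 := by norm_num at hδ; linarith
  set L := Real.log ((1 - δ) / δ) with hL
  have hLpos : 0 < L := Real.log_pos (by rw [lt_div_iff₀ hδ0]; linarith)
  let D : ℕ → ℝ := fun n =>
    ∑ t ∈ Finset.range n, P.real {ω | RunningAt ω t ∧ (ω t).1.IsDuelOf k}
  let N : ℕ → ℝ := fun n =>
    ∑ t ∈ Finset.range n, P.real {ω | RunningAt ω t ∧ (ω t).1.IsPullOf k}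
  have hD0 : ∀ n, 0 ≤ D n := fun n => Finset.sum_nonneg fun _ _ => measureReal_nonneg
  have hN0 : ∀ n, 0 ≤ N n := fun n => Finset.sum_nonneg fun _ _ => measureReal_nonneg
  have hperturb : ∀ n : ℕ, ∀ ε : ℝ, 0 < ε → ε ≤ 1 / 100 →
      (2 * P.real {ω | OutputsBy I.posSet n ω} - 1) * L
        ≤ 10 * (g + ε) ^ 2 * D (n + 1) + (p + ε) ^ 2 / (2 * (R : ℝ) ^ 2) * N (n + 1)
          + (n + 1) * (ε ^ 2 / (2 * (R : ℝ) ^ 2)) := by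
    intro n ε hε hε1
    -- The extra `ε` makes the inequality strict at the positive arm of lowest score.
    have hd : ∀ i, τ ≤ I.μ i → score I.M k - (g + ε) < score I.M i := fun i hi => by
      linarith [I.score_sub_duelGap_le hkτ hi]
    have hdM : ∀ j, g + ε ≤ I.M k j := fun j => by linarith [hM k j]
    have ha : 0 ≤ 10 * (g + ε) ^ 2 := by positivity
    have hb : 0 ≤ (p + ε) ^ 2 / (2 * (R : ℝ) ^ 2) := by positivity
    have he : 0 ≤ ε ^ 2 / (2 * (R : ℝ) ^ 2) := by positivity
    have hd0 : 0 ≤ g + ε := by linarith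
    have hJ := (hA _ (I.lower_mu_ne hK k hε hd0 hd hdM)).measureReal_le (S := I.posSet)
      fun h => I.notMem_posSet_lower hK k hε hd0 hd hdM (h ▸ hk)
    refine (transport_outputsBy A I _ R (abs_armCost_le k ha hb he)
      (RelEntropyLE.obs_lower I hK hM hR hkτ hε hd0 (by linarith) hd hdM)
      I.posSet hδ0 hδ' hJ n).trans ?_
    refine (Finset.sum_le_sum fun t _ => integral_costAt_armCost_le P k ha hb he t).trans ?_
    rw [Finset.sum_add_distrib, Finset.sum_add_distrib, ← Finset.mul_sum, ← Finset.mul_sum,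
      Finset.sum_const, Finset.card_range, nsmul_eq_mul, Nat.cast_add, Nat.cast_one]
  have hlimit : ∀ n : ℕ, (2 * P.real {ω | OutputsBy I.posSet n ω} - 1) * L
      ≤ 10 * g ^ 2 * D (n + 1) + p ^ 2 / (2 * (R : ℝ) ^ 2) * N (n + 1) := by
    intro n
    have hcont : Continuous fun ε : ℝ => 10 * (g + ε) ^ 2 * D (n + 1)
        + (p + ε) ^ 2 / (2 * (R : ℝ) ^ 2) * N (n + 1)
          + (n + 1) * (ε ^ 2 / (2 * (R : ℝ) ^ 2)) := by fun_prop
    -- With `n` fixed the counts are finite and do not depend on `ε`, so `ε → 0` removes the error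
    -- `(n + 1) * ε ^ 2 / (2 * R ^ 2)`.
    have ht := (hcont.tendsto 0).mono_left (nhdsWithin_le_nhds (s := Set.Ioi (0 : ℝ)))
    have := ge_of_tendsto ht (b := (2 * P.real {ω | OutputsBy I.posSet n ω} - 1) * L) (by
      filter_upwards [Ioc_mem_nhdsGT (show (0 : ℝ) < 1 / 100 by norm_num)] with ε hε
      exact hperturb n ε hε.1 hε.2)
    simpa using this
  set c := min (1 / 10) ((R : ℝ) ^ 2 / 2) with hc
  have hc0 : 0 ≤ c := le_min (by norm_num) (by positivity)
  have hc1 : c ≤ 1 / 10 := min_le_left _ _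
  -- There is slack here: `c ≤ 2 * R ^ 2` would suffice.
  have hc2 : c / (2 * (R : ℝ) ^ 2) ≤ 1 := by
    rw [div_le_one (by positivity)]
    have : c ≤ (R : ℝ) ^ 2 / 2 := min_le_right _ _
    nlinarith [sq_nonneg (R : ℝ)]
  set V := ∫⁻ ω, (ENNReal.ofReal (g ^ 2) * numDuels k ω
    + ENNReal.ofReal (p ^ 2) * numPulls k ω) ∂P with hV
  have hbound : ∀ n : ℕ,
      ENNReal.ofReal (c * ((2 * P.real {ω | OutputsBy I.posSet n ω} - 1) * L)) ≤ V := by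
    intro n
    refine le_trans (ENNReal.ofReal_le_ofReal ?_)
      (ofReal_sum_le_lintegral P k (sq_nonneg g) (sq_nonneg p) (n + 1))
    change _ ≤ g ^ 2 * D (n + 1) + p ^ 2 * N (n + 1)
    refine (mul_le_mul_of_nonneg_left (hlimit n) hc0).trans ?_
    have h1 : c * 10 * (g ^ 2 * D (n + 1)) ≤ 1 * (g ^ 2 * D (n + 1)) :=
      mul_le_mul_of_nonneg_right (by linarith) (mul_nonneg (sq_nonneg g) (hD0 _))
    have h2 : c / (2 * (R : ℝ) ^ 2) * (p ^ 2 * N (n + 1)) ≤ 1 * (p ^ 2 * N (n + 1)) :=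
      mul_le_mul_of_nonneg_right hc2 (mul_nonneg (sq_nonneg p) (hN0 _))
    calc c * (10 * g ^ 2 * D (n + 1) + p ^ 2 / (2 * (R : ℝ) ^ 2) * N (n + 1))
        = c * 10 * (g ^ 2 * D (n + 1)) + c / (2 * (R : ℝ) ^ 2) * (p ^ 2 * N (n + 1)) := by ring
      _ ≤ _ := by linarith
  -- Now `n → ∞`: the bound `V` does not depend on `n`, and the events `OutputsBy` increase to
  -- `Outputs`.
  have hfinal : ENNReal.ofReal (c * ((2 * P.real {ω | Outputs I.posSet ω} - 1) * L)) ≤ V :=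
    le_of_tendsto' (ENNReal.tendsto_ofReal ((((tendsto_outputsBy P I.posSet).const_mul 2).sub_const
      1).mul_const L |>.const_mul c)) hbound
  refine (ENNReal.ofReal_le_ofReal (mul_le_mul_of_nonneg_left ?_ hc0)).trans hfinal
  have hPS : 1 - δ ≤ P.real {ω | Outputs I.posSet ω} :=
    (ENNReal.ofReal_le_iff_le_toReal (measure_ne_top _ _)).1 hI
  exact (log_inv_two_mul_le hδ0 hδ).trans (mul_le_mul_of_nonneg_right (by linarith) hLpos.le)
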